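/- For a subset $A$ of a real vector space, $\mathrm{PLC}(A)$ denotes the set of all finite sums $\sum_{a\in A}c_a a$ with all $c_a\ge 0$ and at least one $c_a>0$. Let $V_1,V_2$ be real vector spaces with a bilinear pairing $\langle\,,\rangle\colon V_1\times V_2\to\mathbb R$, and let $\Pi_1=\{\alpha_s\mid s\in S\}\subseteq V_1$ and $\Pi_2=\{\beta_s\mid s\in S\}\subseteq V_2$ be in bijective correspondence with a set $S$. Assume that for all $s,t\in S$: (D1) $\langle\alpha_s,\beta_s\rangle=1$; (D2) $0\notin\mathrm{PLC}(\Pi_i)$ for $i=1,2$, $\alpha_s\notin\mathrm{PLC}(\Pi_1\setminus\{\alpha_s\})$ and $\beta_s\notin\mathrm{PLC}(\Pi_2\setminus\{\beta_s\})$; (D3) $\langle\alpha_s,\beta_t\rangle\le 0$ and $\langle\alpha_t,\beta_s\rangle\le 0$ if $s\ne t$; (D4) $\langle\alpha_s,\beta_t\rangle=0$ if and only if $\langle\alpha_t,\beta_s\rangle=0$; (D5) $\langle\alpha_s,\beta_t\rangle\langle\alpha_t,\beta_s\rangle\in\{\cos^2(\pi/m)\mid m\in\mathbb N,\ m\ge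 2\}\cup[1,\infty)$. Let $(W,R)$ with $R=\{r_s\mid s\in S\}$ be the Coxeter system in which, for $s\ne t$, the order of $r_sr_t$ is $m$ if $\langle\alpha_s,\beta_t\rangle\langle\alpha_t,\beta_s\rangle=\cos^2(\pi/m)$ with $m\ge 2$, and infinite otherwise; let $\ell$ be its length function and $T=\bigcup_{w\in W}wRw^{-1}$. The group $W$ acts on $V_1$ by $r_sx=x-2\langle x,\beta_s\rangle\alpha_s$ and on $V_2$ by $r_sy=y-2\langle\alpha_s,y\rangle\beta_s$. Put $\Phi_i=W\Pi_i$ and $\Phi_i^+=\Phi_i\cap\mathrm{PLC}(\Pi_i)$, let $\phi\colon\Phi_1\to\Phi_2$ be the $W$-equivariant bijection with $\phi(\alpha_s)=\beta_s$ for all $s\in S$, and for $w\in W$ and $s\in S$ put $r_{w\alpha_s}=r_{w\beta_s}=wr_sw^{-1}$; this defines $r_x\in T$ for every $x\in\Phi_1$ and for every $x\in\Phi_2$. For $z\in\Phi_i$ let $\widehat z$ be the set of the elements of $\Phi_i$ that are nonzero scalar multiples of $z$, and for $A\subseteq\Phi_i$ put $\widehat A=\{\widehat z\mid z\in A\}$.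 A subgroup $W'$ of $W$ is called a reflection subgroup if it is generated by $W'\cap T$; for such $W'$ put $$S(W')=\{t\in T\mid \{t'\in T\mid \ell(tt')<\ell(t)\}\cap W'=\{t\}\},\qquad \Delta_i(W')=\{x\in\Phi_i^+\mid r_x\in S(W')\}\quad(i=1,2).$$ Suppose that $\Delta'_1\subseteq\Phi_1^+$ and $\Delta'_2\subseteq\Phi_2^+$ are such that (A1) $\phi(\Delta'_1)=\Delta'_2$; (A2) $\langle x,\phi(x')\rangle\le 0$ for all distinct $x,x'\in\Delta'_1$; (A3) $\langle x,\phi(x')\rangle\langle x',\phi(x)\rangle\in\{\cos^2(\pi/m)\mid m\in\mathbb N,\ m\ge 2\}\cup[1,\infty)$ for all $x,x'\in\Delta'_1$ with $r_x\ne r_{x'}$. Then $W'=\langle\{r_x\mid x\in\Delta'_1\}\rangle$ is a reflection subgroup of $W$, and $\widehat{\Delta'_1}=\widehat{\Delta_1(W')}$ and $\widehat{\Delta'_2}=\widehat{\Delta_2(W')}$. -/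

import Mathlib

noncomputable section

/-- The positive linear cone of a subset `A` of a real vector space: all finite linear combinations
of elements of `A` with nonnegative coefficients, at least one of which is positive. -/
def PLC {V : Type*} [AddCommGroup V] [Module ℝ V] (A : Set V) : Set V :=
  {v | ∃ c : V →₀ ℝ, (c.support : Set V) ⊆ A ∧ (∀ a, 0 ≤ c a) ∧ (∃ a ∈ A, 0 < c a) ∧
    v = c.sum (fun a r => r • a)}

/-- A Coxeter datum: simple roots `α s` in `V₁` and `β s` in `V₂`, indexed bijectively by `S`, and
a bilinear pairing, subject to the conditions (D1) to (D5). -/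
structure CoxeterDatum (S V₁ V₂ : Type*) [AddCommGroup V₁] [Module ℝ V₁]
    [AddCommGroup V₂] [Module ℝ V₂] where
  /-- the bilinear pairing -/
  pair : V₁ →ₗ[ℝ] V₂ →ₗ[ℝ] ℝ
  /-- the simple roots in `V₁` -/
  α : S → V₁
  /-- the simple roots in `V₂` -/
  β : S → V₂
  α_injective : Function.Injective α
  β_injective : Function.Injective β
  D1 : ∀ s, pair (α s) (β s) = 1
  D2_i : 0 ∉ PLC (Set.range α) ∧ 0 ∉ PLC (Set.range β)
  D2_ii : ∀ s, α s ∉ PLC (Set.range α \ {α s}) ∧ β s ∉ PLC (Set.range β \ {β s})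
  D3 : ∀ s t, s ≠ t → pair (α s) (β t) ≤ 0 ∧ pair (α t) (β s) ≤ 0
  D4 : ∀ s t, pair (α s) (β t) = 0 ↔ pair (α t) (β s) = 0
  D5 : ∀ s t,
    (∃ m : ℕ, 2 ≤ m ∧ pair (α s) (β t) * pair (α t) (β s) = Real.cos (Real.pi / m) ^ 2) ∨
      1 ≤ pair (α s) (β t) * pair (α t) (β s)

open Classical in
/-- The integer `m ≥ 2` with `p = cos² (π / m)`, if there is one (it is then unique), and `0`
otherwise. The value `0` stands for `∞`, as in `CoxeterMatrix`. -/
def cosOrder (p : ℝ) : ℕ :=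
  if h : ∃ m : ℕ, 2 ≤ m ∧ p = Real.cos (Real.pi / m) ^ 2 then h.choose else 0

theorem cosOrder_spec {p : ℝ} (h : cosOrder p ≠ 0) :
    2 ≤ cosOrder p ∧ p = Real.cos (Real.pi / cosOrder p) ^ 2 := by
  unfold cosOrder at h ⊢
  split_ifs at h ⊢ with h'
  · exact h'.choose_spec
  · exact absurd rfl h

theorem cosOrder_ne_one (p : ℝ) : cosOrder p ≠ 1 := by
  intro h
  have := (cosOrder_spec (p := p) (by lia)).1
  lia

open Polynomial.Chebyshev in
/-- A product of two reflections has the expected order relation. -/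
theorem reflection_mul_reflection_pow_eq_one {V : Type*} [AddCommGroup V] [Module ℝ V]
    {x y : V} {f g : Module.Dual ℝ V} (hf : f x = 2) (hg : g y = 2) (m : ℕ) (hm : 2 ≤ m)
    (h0 : f y = 0 ↔ g x = 0) (h : f y * g x = 4 * Real.cos (Real.pi / m) ^ 2) :
    (Module.reflection hf * Module.reflection hg) ^ m = 1 := by
  ext z
  rw [Module.reflection_mul_reflection_pow_apply hf hg m z (f y * g x - 2) rfl]
  rcases hm.eq_or_lt with rfl | hm3
  · have hz : f y * g x = 0 := by simpa using h
    have h1 : f y = 0 := by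
      rcases mul_eq_zero.1 hz with h1 | h1
      · exact h1
      · exact h0.2 h1
    have h2 : g x = 0 := h0.1 h1
    norm_num [h1, h2]
    abel
  · set θ : ℝ := Real.pi / m with hθ
    have hmpos : (0 : ℝ) < m := by positivity
    have hmθ : m * θ = Real.pi := by rw [hθ]; field_simp
    have ht : f y * g x - 2 = 2 * Real.cos (2 * θ) := by
      rw [h, Real.cos_two_mul]; ring
    have hs : Real.sin (2 * θ) ≠ 0 := by
      apply ne_of_gt
      apply Real.sin_pos_of_pos_of_lt_pi
      · have := Real.pi_pos
        positivity
      · have h3 : (3 : ℝ) ≤ m := by exact_mod_cast hm3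
        have hθ0 : 0 < θ := div_pos Real.pi_pos hmpos
        nlinarith
    have hS (n : ℤ) : (S ℝ n).eval (2 * Real.cos (2 * θ)) =
        Real.sin ((n + 1) * (2 * θ)) / Real.sin (2 * θ) := by
      rw [eq_div_iff hs]
      exact S_two_mul_real_cos _ _
    rw [ht]
    rcases Nat.even_or_odd' m with ⟨k, hk | hk⟩
    · have e1 : ((m : ℤ) - 2) / 2 = k - 1 := by lia
      have e2 : ((m : ℤ) - 1) / 2 = k - 1 := by lia
      have hv : (S ℝ ((k : ℤ) - 1)).eval (2 * Real.cos (2 * θ)) = 0 := by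
        rw [hS]
        have : (((k : ℤ) - 1 : ℤ) + 1 : ℝ) * (2 * θ) = Real.pi := by
          rw [← hmθ, hk]; push_cast; ring
        rw [this]; simp
      rw [e1, e2, hv]
      simp
    · have e1 : ((m : ℤ) - 2) / 2 = k - 1 := by lia
      have e2 : ((m : ℤ) - 1) / 2 = k := by lia
      have e3 : ((m : ℤ) - 3) / 2 = k - 1 := by lia
      have e4 : (m : ℤ) / 2 = k := by lia
      have hv : (S ℝ (k : ℤ)).eval (2 * Real.cos (2 * θ)) +
          (S ℝ ((k : ℤ) - 1)).eval (2 * Real.cos (2 * θ)) = 0 := by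
        rw [hS, hS]
        have a1 : (((k : ℤ) - 1 : ℤ) + 1 : ℝ) * (2 * θ) = Real.pi - θ := by
          rw [← hmθ, hk]; push_cast; ring
        have a2 : (((k : ℤ) : ℝ) + 1) * (2 * θ) = θ + Real.pi := by
          rw [← hmθ, hk]; push_cast; ring
        rw [a1, a2, Real.sin_pi_sub, Real.sin_add_pi]
        ring
      rw [e1, e2, e3, e4, hv]
      simp

namespace CoxeterDatum

variable {S V₁ V₂ : Type*} [AddCommGroup V₁] [Module ℝ V₁] [AddCommGroup V₂] [Module ℝ V₂]
variable (C : CoxeterDatum S V₁ V₂)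

/-- The reflection `ρ₁ s` of `V₁`, `x ↦ x - 2 ⟨x, β s⟩ α s`. -/
def ρ₁ (s : S) : V₁ ≃ₗ[ℝ] V₁ :=
  Module.reflection (x := C.α s) (f := (2 : ℝ) • C.pair.flip (C.β s)) (by simp [C.D1])

/-- The reflection `ρ₂ s` of `V₂`, `y ↦ y - 2 ⟨α s, y⟩ β s`. -/
def ρ₂ (s : S) : V₂ ≃ₗ[ℝ] V₂ :=
  Module.reflection (x := C.β s) (f := (2 : ℝ) • C.pair (C.α s)) (by simp [C.D1])

theorem ρ₁_apply (s : S) (x : V₁) : C.ρ₁ s x = x - (2 * C.pair x (C.β s)) • C.α s := by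
  simp [ρ₁, Module.reflection_apply]

theorem ρ₂_apply (s : S) (y : V₂) : C.ρ₂ s y = y - (2 * C.pair (C.α s) y) • C.β s := by
  simp [ρ₂, Module.reflection_apply]

open Classical in
/-- The Coxeter matrix `(m_{st})` of the datum (`0` stands for `∞`). -/
def matrix : CoxeterMatrix S where
  M := fun s t => if s = t then 1 else
    cosOrder (C.pair (C.α s) (C.β t) * C.pair (C.α t) (C.β s))
  isSymm := by
    refine Matrix.IsSymm.ext fun s t => ?_
    rw [mul_comm]
    by_cases h : s = t
    · subst h; rfl
    · rw [if_neg h, if_neg (Ne.symm h)]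
  diagonal := by simp
  off_diagonal := by
    intro s t hst
    simp [hst, cosOrder_ne_one]

/-- The abstract Coxeter group `W` of the datum. -/
abbrev W : Type _ := C.matrix.Group

/-- The abstract Coxeter system `(W, R)` of the datum; its simple reflections are the `r_s`. -/
abbrev system : CoxeterSystem C.matrix C.W := C.matrix.toCoxeterSystem

theorem liftable₁ : C.matrix.IsLiftable C.ρ₁ := by
  intro s t
  by_cases hst : s = t
  · subst hst
    rw [C.matrix.diagonal, pow_one]
    ext x
    exact Module.involutive_reflection (x := C.α s) _ x
  · have hM : C.matrix s t = cosOrder (C.pair (C.α s) (C.β t) * C.pair (C.α t) (C.β s)) := by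
      simp [matrix, hst]
    rw [hM]
    by_cases h0 : cosOrder (C.pair (C.α s) (C.β t) * C.pair (C.α t) (C.β s)) = 0
    · rw [h0, pow_zero]
    · obtain ⟨h2, hp⟩ := cosOrder_spec h0
      refine reflection_mul_reflection_pow_eq_one _ _ _ h2 ?_ ?_
      · simpa using C.D4 t s
      · rw [← hp]
        simp
        ring

theorem liftable₂ : C.matrix.IsLiftable C.ρ₂ := by
  intro s t
  by_cases hst : s = t
  · subst hst
    rw [C.matrix.diagonal, pow_one]
    ext x
    exact Module.involutive_reflection (x := C.β s) _ x
  · have hM : C.matrix s t = cosOrder (C.pair (C.α s) (C.β t) * C.pair (C.α t) (C.β s)) := by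
      simp [matrix, hst]
    rw [hM]
    by_cases h0 : cosOrder (C.pair (C.α s) (C.β t) * C.pair (C.α t) (C.β s)) = 0
    · rw [h0, pow_zero]
    · obtain ⟨h2, hp⟩ := cosOrder_spec h0
      refine reflection_mul_reflection_pow_eq_one _ _ _ h2 ?_ ?_
      · simpa using C.D4 s t
      · rw [← hp]
        simp
        ring

/-- The action of `W` on `V₁`, given by `r_s ↦ ρ₁ s`. -/
def act₁ : C.W →* (V₁ ≃ₗ[ℝ] V₁) := C.system.lift ⟨C.ρ₁, C.liftable₁⟩

/-- The action of `W` on `V₂`, given by `r_s ↦ ρ₂ s`. -/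
def act₂ : C.W →* (V₂ ≃ₗ[ℝ] V₂) := C.system.lift ⟨C.ρ₂, C.liftable₂⟩

theorem act₁_simple (s : S) : C.act₁ (C.system.simple s) = C.ρ₁ s :=
  C.system.lift_apply_simple C.liftable₁ s

theorem act₂_simple (s : S) : C.act₂ (C.system.simple s) = C.ρ₂ s :=
  C.system.lift_apply_simple C.liftable₂ s

/-- The root system `Φ₁`: the `W`-orbit of the simple roots in `V₁`. -/
def Φ₁ : Set V₁ := {x | ∃ p : C.W × S, C.act₁ p.1 (C.α p.2) = x}

/-- The root system `Φ₂`: the `W`-orbit of the simple roots in `V₂`. -/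
def Φ₂ : Set V₂ := {y | ∃ p : C.W × S, C.act₂ p.1 (C.β p.2) = y}

/-- The positive roots in `V₁`. -/
def Φ₁pos : Set V₁ := C.Φ₁ ∩ PLC (Set.range C.α)

/-- The positive roots in `V₂`. -/
def Φ₂pos : Set V₂ := C.Φ₂ ∩ PLC (Set.range C.β)

open Classical in
/-- The `W`-equivariant map `φ : Φ₁ → Φ₂` with `φ (α s) = β s`: the root `w (α s)` is sent to
`w (β s)`. (The value does not depend on the choice of `w` and `s`, and there is only one such
map; outside `Φ₁` the value is irrelevant.) -/
def φ (x : V₁) : V₂ :=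
  if h : ∃ p : C.W × S, C.act₁ p.1 (C.α p.2) = x then C.act₂ h.choose.1 (C.β h.choose.2) else 0

open Classical in
/-- The reflection `r_x` in `W` corresponding to `x ∈ Φ₁`: if `x = w (α s)` then
`r_x = w r_s w⁻¹`. (It does not depend on the choice of `w` and `s`; outside `Φ₁` the value is
irrelevant.) -/
def refl₁ (x : V₁) : C.W :=
  if h : ∃ p : C.W × S, C.act₁ p.1 (C.α p.2) = x then
    h.choose.1 * C.system.simple h.choose.2 * h.choose.1⁻¹ else 1

open Classical in
/-- The reflection `r_y` in `W` corresponding to `y ∈ Φ₂`: if `y = w (β s)` then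
`r_y = w r_s w⁻¹`. (It does not depend on the choice of `w` and `s`; outside `Φ₂` the value is
irrelevant.) -/
def refl₂ (y : V₂) : C.W :=
  if h : ∃ p : C.W × S, C.act₂ p.1 (C.β p.2) = y then
    h.choose.1 * C.system.simple h.choose.2 * h.choose.1⁻¹ else 1

/-- The set `T` of reflections in `W`. -/
def T : Set C.W := {t | C.system.IsReflection t}

/-- `W'` is a reflection subgroup if it is generated by the reflections it contains. -/
def IsReflectionSubgroup (W' : Subgroup C.W) : Prop :=
  W' = Subgroup.closure ((W' : Set C.W) ∩ C.T)

/-- `Nbar w = {t ∈ T | ℓ (w t) < ℓ w}`. -/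
def Nbar (w : C.W) : Set C.W :=
  {t | t ∈ C.T ∧ C.system.length (w * t) < C.system.length w}

/-- The canonical generators `S(W')` of a reflection subgroup `W'`. -/
def canonicalGenerators (W' : Subgroup C.W) : Set C.W :=
  {t | t ∈ C.T ∧ C.Nbar t ∩ (W' : Set C.W) = {t}}

/-- The canonical simple roots `Δ₁(W')` of `W'` in `Φ₁`. -/
def Δ₁ (W' : Subgroup C.W) : Set V₁ := {x | x ∈ C.Φ₁pos ∧ C.refl₁ x ∈ C.canonicalGenerators W'}

/-- The canonical simple roots `Δ₂(W')` of `W'` in `Φ₂`. -/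
def Δ₂ (W' : Subgroup C.W) : Set V₂ := {y | y ∈ C.Φ₂pos ∧ C.refl₂ y ∈ C.canonicalGenerators W'}

/-- For `A ⊆ Φ₁`, the set of the equivalence classes of the elements of `A`, where two roots in
`Φ₁` are equivalent if they are nonzero scalar multiples of each other. -/
def hat₁ (A : Set V₁) : Set (Set V₁) :=
  (fun z => {z' | z' ∈ C.Φ₁ ∧ ∃ c : ℝ, c ≠ 0 ∧ z' = c • z}) '' A

/-- For `A ⊆ Φ₂`, the set of the equivalence classes of the elements of `A`, where two roots in
`Φ₂` are equivalent if they are nonzero scalar multiples of each other. -/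
def hat₂ (A : Set V₂) : Set (Set V₂) :=
  (fun z => {z' | z' ∈ C.Φ₂ ∧ ∃ c : ℝ, c ≠ 0 ∧ z' = c • z}) '' A

end CoxeterDatum

end

/-! The conditions on `Δ₁'` are those on simple roots, so `Δ₁'` and `φ(Δ₁')` are themselves the
simple roots of a Coxeter datum `D` in the same spaces (`subdatum`). Irredundancy (D2) holds because
pairing with `φ(x)` is `1` at `x` and nonpositive on the rest of `Δ₁'`; (D4) holds because
orthogonality of roots is symmetric (`pair_φ_eq_zero_of_pair_φ_eq_zero`).

The basic fact about any datum is that `w α_s` is a nonnegative combination of simple roots when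
`ℓ(w r_s) > ℓ(w)`, and the negative of one otherwise (`RootRep.act_root_mem_cone`). It is proved by
reduction to rank two, where the coefficients are Chebyshev values. It makes the action faithful and
describes `ℓ(wt) < ℓ(w)`, for a reflection `t`, by the sign of a root (`length_mul_conj_lt_iff`).

Each `w ≠ 1` in `W'` acts on `V₁` as a nontrivial element of the group of `D`, so it sends some `x ∈
Δ₁'` into the negative of the cone of `Δ₁'`. Two things follow. Taking `w = r_z` shows that every
positive root `z` with `r_z ∈ W'` lies in the cone of `Δ₁'`. Taking `w = t ∈ S(W')` gives `r_x ∈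
N(t) ∩ W' = {t}`, where `N` is `Nbar`. Conversely, if `r_z ∈ N(r_x) ∩ W'` with `x ∈ Δ₁'`, then `z`
and `-r_x z` lie in the cone of `Δ₁'` and add up to a multiple of `x`; irredundancy forces `z` to be
a multiple of `x`. So `S(W') = {r_x | x ∈ Δ₁'}`, and since a reflection determines its root up to a
scalar, the classes agree. -/

open scoped NNReal

/-! ### Convex cones and irredundant generating sets -/

section Cone

variable {V : Type*} [AddCommGroup V] [Module ℝ V]

/-- The convex cone generated by `A`, including `0`. -/
abbrev nonnegSpan (A : Set V) : Submodule ℝ≥0 V := Submodule.span ℝ≥0 A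

theorem smul_mem_nonnegSpan {A : Set V} {r : ℝ} (hr : 0 ≤ r) {x : V} (hx : x ∈ nonnegSpan A) :
    r • x ∈ nonnegSpan A :=
  (nonnegSpan A).smul_mem ⟨r, hr⟩ hx

theorem mem_nonnegSpan_of_mem_PLC {A : Set V} {x : V} (hx : x ∈ PLC A) : x ∈ nonnegSpan A := by
  obtain ⟨c, hc, h0, -, rfl⟩ := hx
  exact Submodule.sum_mem _ fun a ha =>
    smul_mem_nonnegSpan (h0 a) (Submodule.subset_span (hc ha))

theorem smul_add_mem_PLC {A : Set V} {a y : V} {r : ℝ} (ha : a ∈ A) (hr : 0 < r)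
    (hy : y ∈ nonnegSpan A) : r • a + y ∈ PLC A := by
  classical
  obtain ⟨f, t, ht, -, rfl⟩ := Submodule.mem_span_iff_exists_finset_subset.1 hy
  set d : V →₀ ℝ := ∑ b ∈ t, Finsupp.single b (f b : ℝ) with hd
  have hd0 : ∀ b, 0 ≤ d b := by
    intro b
    rw [hd, Finsupp.finsetSum_apply]
    refine Finset.sum_nonneg fun i _ => ?_
    rw [Finsupp.single_apply]
    split_ifs <;> simp
  refine ⟨Finsupp.single a r + d, ?_, ?_, ⟨a, ha, ?_⟩, ?_⟩
  · intro b hb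
    by_contra hbA
    have h1 : a ≠ b := fun h => hbA (h ▸ ha)
    have h2 : d b = 0 := by
      rw [hd, Finsupp.finsetSum_apply]
      refine Finset.sum_eq_zero fun i hi => ?_
      rw [Finsupp.single_apply, if_neg]
      rintro rfl
      exact hbA (ht hi)
    simp [h1, h2] at hb
  · intro b
    have : 0 ≤ Finsupp.single a r b := by
      rw [Finsupp.single_apply]
      split_ifs
      · exact hr.le
      · exact le_rfl
    exact add_nonneg this (hd0 b)
  · simpa using add_pos_of_pos_of_nonneg hr (hd0 a)
  · rw [Finsupp.sum_add_index' (by simp) (by intros; rw [add_smul]),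
      Finsupp.sum_single_index (by simp), hd,
      ← Finsupp.sum_finsetSum_index (by simp) (by intros; rw [add_smul])]
    congr 1
    refine Finset.sum_congr rfl fun b _ => ?_
    rw [Finsupp.sum_single_index (by simp)]
    rfl

theorem exists_eq_smul_add_of_mem_PLC {A : Set V} {x : V} (hx : x ∈ PLC A) :
    ∃ a ∈ A, ∃ r : ℝ, 0 < r ∧ ∃ y ∈ nonnegSpan A, x = r • a + y := by
  classical
  obtain ⟨c, hc, h0, ⟨a, ha, hca⟩, rfl⟩ := hx
  refine ⟨a, ha, c a, hca, (c.erase a).sum fun a r => r • a,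
    Submodule.sum_mem _ fun b hb => ?_, ?_⟩
  · rw [Finsupp.support_erase, Finset.mem_erase] at hb
    rw [Finsupp.erase_ne hb.1]
    exact smul_mem_nonnegSpan (h0 b) (Submodule.subset_span (hc hb.2))
  · exact (Finsupp.add_sum_erase' c a (fun a r => r • a) (by simp)).symm

theorem mem_PLC_of_mem_nonnegSpan {A : Set V} {x : V} (hx : x ∈ nonnegSpan A) (h : x ≠ 0) :
    x ∈ PLC A := by
  induction hx using Submodule.closure_induction with
  | zero => exact absurd rfl h
  | add x y hx hy ihx ihy =>
    by_cases hx0 : x = 0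
    · subst hx0
      rw [zero_add] at h ⊢
      exact ihy h
    · obtain ⟨a, ha, r, hr, z, hz, rfl⟩ := exists_eq_smul_add_of_mem_PLC (ihx hx0)
      rw [add_assoc]
      exact smul_add_mem_PLC ha hr (add_mem hz hy)
  | smul_mem r x hx =>
    have hr : 0 < (r : ℝ) := lt_of_le_of_ne r.2 fun h' => h (by
      rw [NNReal.smul_def, ← h', zero_smul])
    have := smul_add_mem_PLC (A := A) hx hr (zero_mem _)
    rwa [add_zero] at this

theorem eq_zero_of_neg_mem_nonnegSpan {A : Set V} (h0 : 0 ∉ PLC A) {x : V}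
    (hx : x ∈ nonnegSpan A) (hx' : -x ∈ nonnegSpan A) : x = 0 := by
  by_contra h
  obtain ⟨a, ha, r, hr, z, hz, hs⟩ :=
    exists_eq_smul_add_of_mem_PLC (mem_PLC_of_mem_nonnegSpan hx h)
  have : (0 : V) = r • a + (z + -x) := by
    rw [← add_assoc, ← hs, add_neg_cancel]
  rw [this] at h0
  exact h0 (smul_add_mem_PLC ha hr (add_mem hz hx'))

/-- An irredundant generator spans an extremal ray. Split off the `a`-components of `y` and `z`; the
remainders `y'`, `z'` add up to a multiple of `a`. A positive multiple would put `a` in `PLC (A \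
{a})`; otherwise `-y'` is in the cone, so `y' = 0`. -/
theorem exists_smul_eq_of_add_eq_smul {A : Set V} (h0 : 0 ∉ PLC A) {a : V} (ha : a ∈ A)
    (haA : a ∉ PLC (A \ {a})) {y z : V} (hy : y ∈ nonnegSpan A) (hz : z ∈ nonnegSpan A) {k : ℝ}
    (h : y + z = k • a) : ∃ c : ℝ, 0 ≤ c ∧ y = c • a := by
  have hins : insert a (A \ {a}) = A := by simp [ha]
  have ha0 : a ≠ 0 := by
    rintro rfl
    apply h0
    simpa using smul_add_mem_PLC ha one_pos (zero_mem _)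
  rw [nonnegSpan, ← hins, Submodule.mem_span_insert] at hy hz
  obtain ⟨p, y', hy', rfl⟩ := hy
  obtain ⟨q, z', hz', rfl⟩ := hz
  rw [NNReal.smul_def, NNReal.smul_def] at h
  have hle : nonnegSpan (A \ {a}) ≤ nonnegSpan A := Submodule.span_mono Set.sdiff_subset
  have hsum : y' + z' = (k - p - q) • a := by
    rw [sub_smul, sub_smul, ← h]; abel
  rcases lt_or_ge 0 (k - p - q) with hk | hk
  · refine absurd (mem_PLC_of_mem_nonnegSpan ?_ ha0) haA
    have : a = (k - p - q)⁻¹ • (y' + z') := by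
      rw [hsum, smul_smul, inv_mul_cancel₀ hk.ne', one_smul]
    have h' := smul_mem_nonnegSpan (inv_nonneg.2 hk.le) (add_mem hy' hz')
    rwa [← this] at h'
  · have hy0 : y' = 0 := by
      refine eq_zero_of_neg_mem_nonnegSpan h0 (hle hy') ?_
      have : -y' = z' + (-(k - p - q)) • a := by
        rw [neg_smul, ← hsum]; abel
      rw [this]
      exact add_mem (hle hz')
        (smul_mem_nonnegSpan (by linarith) (Submodule.subset_span ha))
    exact ⟨p, p.2, by rw [hy0, add_zero]; rfl⟩

end Cone

/-! ### Nonnegativity of the rank two coefficients -/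

/-- The rescaled Chebyshev sequence `u 0 = 0`, `u 1 = 1`, `u (k + 2) = c u (k + 1) - u k`. -/
def dihedralCoeff (c : ℝ) : ℕ → ℝ
  | 0 => 0
  | 1 => 1
  | k + 2 => c * dihedralCoeff c (k + 1) - dihedralCoeff c k

theorem dihedralCoeff_two_mul_cos (θ : ℝ) (k : ℕ) :
    dihedralCoeff (2 * Real.cos θ) k * Real.sin θ = Real.sin (k * θ) := by
  induction k using Nat.twoStepInduction with
  | zero => simp [dihedralCoeff]
  | one => simp [dihedralCoeff]
  | more k ih₁ ih₂ =>
    rw [dihedralCoeff, sub_mul, ih₁, mul_assoc, ih₂]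
    have e₁ : ((k + 2 : ℕ) : ℝ) * θ = ((k + 1 : ℕ) : ℝ) * θ + θ := by push_cast; ring
    have e₂ : (k : ℝ) * θ = ((k + 1 : ℕ) : ℝ) * θ - θ := by push_cast; ring
    rw [e₁, e₂, Real.sin_add, Real.sin_sub]
    ring

/-- The value is `sin (kθ) / sin θ` with `θ = π / m`, and `kθ ≤ π`. -/
theorem dihedralCoeff_cos_nonneg {m : ℕ} (hm : 2 ≤ m) {k : ℕ} (hk : k ≤ m) :
    0 ≤ dihedralCoeff (2 * Real.cos (Real.pi / m)) k := by
  have hm0 : (0 : ℝ) < m := by positivity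
  have hpi := Real.pi_pos
  have hs : 0 < Real.sin (Real.pi / m) := by
    apply Real.sin_pos_of_pos_of_lt_pi (by positivity)
    exact div_lt_self hpi (by exact_mod_cast hm)
  have h : 0 ≤ Real.sin (k * (Real.pi / m)) := by
    apply Real.sin_nonneg_of_nonneg_of_le_pi (by positivity)
    have hkm : (k : ℝ) ≤ m := by exact_mod_cast hk
    calc (k : ℝ) * (Real.pi / m) ≤ m * (Real.pi / m) := by gcongr
      _ = Real.pi := by field_simp
  rw [← dihedralCoeff_two_mul_cos] at h
  exact nonneg_of_mul_nonneg_left h hs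

/-- For `c ≥ 2` the sequence is nondecreasing; the induction carries both properties. -/
theorem dihedralCoeff_nonneg {c : ℝ} (hc : 2 ≤ c) (k : ℕ) : 0 ≤ dihedralCoeff c k := by
  have h (k : ℕ) : 0 ≤ dihedralCoeff c k ∧ dihedralCoeff c k ≤ dihedralCoeff c (k + 1) := by
    induction k with
    | zero => simp [dihedralCoeff]
    | succ k ih =>
      refine ⟨ih.1.trans ih.2, ?_⟩
      rw [dihedralCoeff]
      nlinarith
  exact (h k).1

/-! ### Length and positivity of roots, for `V₁` and `V₂` at once -/

/-- A representation of a Coxeter group by reflections in which the simple reflections come from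
roots and coroots satisfying the conditions of one side of a Coxeter datum. -/
structure RootRep {S W : Type*} [Group W] {M : CoxeterMatrix S} (cs : CoxeterSystem M W)
    (V : Type*) [AddCommGroup V] [Module ℝ V] where
  /-- the action -/
  act : W →* (V ≃ₗ[ℝ] V)
  /-- the simple roots -/
  root : S → V
  /-- the simple coroots, normalized to take the value `1` on the simple roots -/
  coroot : S → Module.Dual ℝ V
  coroot_root_self : ∀ s, coroot s (root s) = 1
  act_simple : ∀ s x, act (cs.simple s) x = x - (2 * coroot s x) • root s
  zero_notMem : 0 ∉ PLC (Set.range root)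
  root_notMem : ∀ s, root s ∉ PLC (Set.range root \ {root s})
  coroot_nonpos : ∀ s t, s ≠ t → coroot t (root s) ≤ 0
  coroot_eq_zero : ∀ s t, coroot t (root s) = 0 → coroot s (root t) = 0
  coroot_mul_of_ne_zero : ∀ s t, s ≠ t → M s t ≠ 0 →
    coroot t (root s) * coroot s (root t) = Real.cos (Real.pi / M s t) ^ 2
  coroot_mul_of_eq_zero : ∀ s t, s ≠ t → M s t = 0 → 1 ≤ coroot t (root s) * coroot s (root t)

namespace RootRep

variable {S W : Type*} [Group W] {M : CoxeterMatrix S} {cs : CoxeterSystem M W}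
  {V : Type*} [AddCommGroup V] [Module ℝ V] (R : RootRep cs V)

/-- The cone of nonnegative combinations of simple roots. -/
abbrev cone : Submodule ℝ≥0 V := nonnegSpan (Set.range R.root)

theorem root_mem_cone (s : S) : R.root s ∈ R.cone := Submodule.subset_span ⟨s, rfl⟩

theorem eq_zero_of_neg_mem_cone {x : V} (hx : x ∈ R.cone) (hx' : -x ∈ R.cone) : x = 0 :=
  eq_zero_of_neg_mem_nonnegSpan R.zero_notMem hx hx'

theorem act_mul (w v : W) (x : V) : R.act (w * v) x = R.act w (R.act v x) := by
  rw [map_mul]; rfl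

theorem act_one (x : V) : R.act 1 x = x := by
  rw [map_one]; rfl

theorem act_act_inv (w : W) (x : V) : R.act w (R.act w⁻¹ x) = x := by
  rw [← act_mul, mul_inv_cancel, act_one]

theorem act_inv_act (w : W) (x : V) : R.act w⁻¹ (R.act w x) = x := by
  rw [← act_mul, inv_mul_cancel, act_one]

theorem act_simple_root (s : S) : R.act (cs.simple s) (R.root s) = -R.root s := by
  rw [act_simple, coroot_root_self, mul_one, two_smul]; abel

theorem root_ne_zero (s : S) : R.root s ≠ 0 := by
  intro h
  have := R.coroot_root_self s
  simp [h] at this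

theorem act_root_ne_zero (w : W) (s : S) : R.act w (R.root s) ≠ 0 := by
  simpa using R.root_ne_zero s

theorem coroot_mul_nonneg {s t : S} (hst : s ≠ t) :
    0 ≤ R.coroot t (R.root s) * R.coroot s (R.root t) :=
  mul_nonneg_of_nonpos_of_nonpos (R.coroot_nonpos s t hst) (R.coroot_nonpos t s hst.symm)

/-- The factor `a / c` rescales `root t` so that both reflections act through the same recursion,
even when the two pairings differ. -/
theorem act_alternatingWord {s t : S} (hst : s ≠ t) (k : ℕ) :
    R.act (cs.wordProd (CoxeterSystem.alternatingWord s t k)) (R.root s) =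
      let c := 2 * √(R.coroot t (R.root s) * R.coroot s (R.root t))
      let a := -2 * R.coroot t (R.root s)
      if Even k then dihedralCoeff c (k + 1) • R.root s + (a / c * dihedralCoeff c k) • R.root t
      else dihedralCoeff c k • R.root s + (a / c * dihedralCoeff c (k + 1)) • R.root t := by
  have hnn := R.coroot_mul_nonneg hst
  have hsq := Real.mul_self_sqrt hnn
  have hzero := R.coroot_eq_zero s t
  have hzero' := R.coroot_eq_zero t s
  have hs := R.coroot_root_self s
  have ht := R.coroot_root_self t
  generalize hx : R.coroot t (R.root s) = x at *
  generalize hy : R.coroot s (R.root t) = y at *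
  generalize hr : √(x * y) = r at *
  -- When `r = 0` both pairings vanish, so the convention that division by `0` gives `0` is harmless
  -- in `e₁` and `e₂`.
  have hr0 : r = 0 → x = 0 ∧ y = 0 := by
    rintro rfl
    have : x * y = 0 := by rw [← hsq]; ring
    rcases mul_eq_zero.1 this with h | h
    · exact ⟨h, hzero h⟩
    · exact ⟨hzero' h, h⟩
  have e₁ : -2 * x / (2 * r) * (2 * r) = -2 * x := by
    by_cases h : r = 0
    · simp [(hr0 h).1]
    · field_simp
  have e₂ : -2 * y * (-2 * x / (2 * r)) = 2 * r := by
    by_cases h : r = 0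
    · simp [(hr0 h).1, h]
    · field_simp
      linarith [hsq]
  dsimp only
  generalize -2 * x / (2 * r) = q at *
  induction k with
  | zero => simp [CoxeterSystem.alternatingWord, dihedralCoeff]
  | succ k ih =>
    rw [CoxeterSystem.alternatingWord_succ', cs.wordProd_cons, act_mul, ih]
    by_cases hk : Even k
    · have hk' : ¬ Even (k + 1) := by simpa [Nat.even_add_one] using hk
      rw [if_pos hk, if_pos hk, if_neg hk', act_simple, dihedralCoeff]
      simp only [map_add, map_smul, hx, ht, smul_eq_mul, mul_one]
      have : q * (2 * r * dihedralCoeff (2 * r) (k + 1) - dihedralCoeff (2 * r) k) =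
          q * dihedralCoeff (2 * r) k -
            2 * (dihedralCoeff (2 * r) (k + 1) * x + q * dihedralCoeff (2 * r) k) := by
        linear_combination dihedralCoeff (2 * r) (k + 1) * e₁
      rw [this, sub_smul (q * _)]
      abel
    · have hk' : Even (k + 1) := by simpa [Nat.even_add_one] using hk
      rw [if_neg hk, if_neg hk, if_pos hk', act_simple, dihedralCoeff]
      simp only [map_add, map_smul, hy, hs, smul_eq_mul, mul_one]
      have : 2 * r * dihedralCoeff (2 * r) (k + 1) - dihedralCoeff (2 * r) k =
          dihedralCoeff (2 * r) k -
            2 * (dihedralCoeff (2 * r) k + q * dihedralCoeff (2 * r) (k + 1) * y) := by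
        linear_combination -dihedralCoeff (2 * r) (k + 1) * e₂
      rw [this, sub_smul (dihedralCoeff _ _)]
      abel

theorem exists_act_alternatingWord {s t : S} (hst : s ≠ t) {k : ℕ}
    (hk : M s t = 0 ∨ k < M s t) : ∃ p q : ℝ, 0 ≤ p ∧ 0 ≤ q ∧
      R.act (cs.wordProd (CoxeterSystem.alternatingWord s t k)) (R.root s) =
        p • R.root s + q • R.root t := by
  have hnn := R.coroot_mul_nonneg hst
  -- The largest index that occurs is `k + 1`, and `k < M s t` keeps it within the range `j ≤ M s t`
  -- where the sines are nonnegative.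
  have hu (j : ℕ) (hj : j ≤ k + 1) :
      0 ≤ dihedralCoeff (2 * √(R.coroot t (R.root s) * R.coroot s (R.root t))) j := by
    by_cases h0 : M s t = 0
    · apply dihedralCoeff_nonneg
      have := Real.one_le_sqrt.2 (R.coroot_mul_of_eq_zero s t hst h0)
      linarith
    · have hkm : k < M s t := hk.resolve_left h0
      have h2 : 2 ≤ M s t := by
        have := M.off_diagonal s t hst
        lia
      have hcos : 0 ≤ Real.cos (Real.pi / M s t) := by
        apply Real.cos_nonneg_of_mem_Icc
        have := Real.pi_pos
        constructor
        · have : 0 ≤ Real.pi / M s t := by positivity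
          linarith
        · have h2' : (2 : ℝ) ≤ M s t := by exact_mod_cast h2
          gcongr
      rw [R.coroot_mul_of_ne_zero s t hst h0, Real.sqrt_sq hcos]
      exact dihedralCoeff_cos_nonneg h2 (by lia)
  have hq : 0 ≤ -2 * R.coroot t (R.root s) /
      (2 * √(R.coroot t (R.root s) * R.coroot s (R.root t))) := by
    have := R.coroot_nonpos s t hst
    apply div_nonneg
    · linarith
    · positivity
  rw [act_alternatingWord R hst]
  dsimp only
  split_ifs
  · exact ⟨_, _, hu _ le_rfl, mul_nonneg hq (hu _ (by lia)), rfl⟩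
  · exact ⟨_, _, hu _ (by lia), mul_nonneg hq (hu _ le_rfl), rfl⟩

open CoxeterSystem in
/-- Stripping an alternating word in `s, t` from the right of `w` as long as the length decreases
produces an element with neither `s` nor `t` as a right descent. -/
theorem exists_alternatingWord_factorization {w : W} {s t : S}
    (hs : cs.length w < cs.length (w * cs.simple s))
    (ht : cs.length (w * cs.simple t) < cs.length w) :
    ∃ (v : W) (k : ℕ), w = v * cs.wordProd (alternatingWord s t k) ∧ cs.length v < cs.length w ∧
      cs.length v < cs.length (v * cs.simple s) ∧ cs.length v < cs.length (v * cs.simple t) ∧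
      (M s t = 0 ∨ k < M s t) := by
  classical
  set v : ℕ → W := fun k => w * (cs.wordProd (alternatingWord s t k))⁻¹ with hv
  have hv0 : v 0 = w := by simp [hv, alternatingWord]
  have hvs (k : ℕ) : v (k + 1) = v k * cs.simple (if Even k then t else s) := by
    simp only [hv]
    rw [alternatingWord_succ', cs.wordProd_cons, mul_inv_rev, cs.inv_simple, mul_assoc]
  -- The length cannot drop forever; the first index at which it rises gives the required element.
  have hex : ∃ k, cs.length (v k) < cs.length (v (k + 1)) := by
    by_contra! hcon
    have (k : ℕ) : cs.length (v k) + k ≤ cs.length w := by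
      induction k with
      | zero => simp [hv0]
      | succ k ih =>
        have h1 := hcon k
        have h2 := cs.length_mul_simple_ne (v k) (if Even k then t else s)
        rw [← hvs] at h2
        lia
    have := this (cs.length w + 1)
    lia
  have hmin : ∀ j < Nat.find hex, cs.length (v (j + 1)) + 1 = cs.length (v j) := by
    intro j hj
    have h1 := Nat.find_min hex hj
    have h2 := cs.length_mul_simple (v j) (if Even j then t else s)
    rw [← hvs] at h2
    lia
  have hlen : ∀ j ≤ Nat.find hex, cs.length (v j) + j = cs.length w := by
    intro j hj
    induction j with
    | zero => simp [hv0]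
    | succ j ih =>
      have := hmin j (by lia)
      have := ih (by lia)
      lia
  have hspec := Nat.find_spec hex
  generalize Nat.find hex = k at *
  have hk0 : k ≠ 0 := by
    rintro rfl
    rw [hvs, hv0] at hspec
    simp only [Even.zero, if_true] at hspec
    lia
  obtain ⟨j, rfl⟩ := Nat.exists_eq_succ_of_ne_zero hk0
  have hnext : cs.length (v (j + 1)) <
      cs.length (v (j + 1) * cs.simple (if Even j then s else t)) := by
    rw [hvs (j + 1)] at hspec
    simpa only [Nat.even_add_one, ite_not] using hspec
  have hprev : cs.length (v (j + 1)) <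
      cs.length (v (j + 1) * cs.simple (if Even j then t else s)) := by
    have : v (j + 1) * cs.simple (if Even j then t else s) = v j := by
      rw [hvs j, mul_assoc, cs.simple_mul_simple_self, mul_one]
    rw [this]
    have := hmin j (by lia)
    lia
  refine ⟨v (j + 1), j + 1, by simp [hv], ?_, ?_, ?_, ?_⟩
  · have := hlen (j + 1) le_rfl
    lia
  · by_cases hj : Even j
    · simpa only [hj, if_true] using hnext
    · simpa only [hj, if_false] using hprev
  · by_cases hj : Even j
    · simpa only [hj, if_true] using hprev
    · simpa only [hj, if_false] using hnext
  -- If `M s t` letters were stripped, the braid relation would let the stripping begin with `s`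
  -- instead. That first step lengthens `w`, and the other `M s t - 1` letters cannot bring the
  -- length down to `ℓ(w) - M s t`.
  · by_contra! hcon
    obtain ⟨hM, hle⟩ := hcon
    have h1 := hlen (M s t) hle
    obtain ⟨n, hn⟩ := Nat.exists_eq_succ_of_ne_zero hM
    have h2 : v (M s t) = w * cs.simple s * (cs.wordProd (alternatingWord s t n))⁻¹ := by
      have hbraid : cs.wordProd (alternatingWord s t (M s t)) =
          cs.wordProd (alternatingWord t s (M s t)) := by
        have := cs.wordProd_braidWord_eq s t
        rwa [braidWord, braidWord, M.symmetric t s] at this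
      simp only [hv]
      rw [hbraid, hn, alternatingWord_succ, List.concat_eq_append, cs.wordProd_append,
        cs.wordProd_singleton, mul_inv_rev, cs.inv_simple, mul_assoc]
    have h3 := cs.length_le_length_mul_add_right (w * cs.simple s)
      (cs.wordProd (alternatingWord s t n))⁻¹
    rw [← h2, cs.length_inv] at h3
    have h4 := cs.length_wordProd_le (alternatingWord s t n)
    rw [length_alternatingWord] at h4
    lia

/-- Write `w` as `v` times an alternating word in `s` and a right descent `t`, with neither letter a
descent of `v`. The word sends `root s` to a nonnegative combination of `root s` and `root t`, and
induction on length applies to `v` on both. -/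
theorem act_root_mem_cone (w : W) (s : S) (h : cs.length w < cs.length (w * cs.simple s)) :
    R.act w (R.root s) ∈ R.cone := by
  induction hn : cs.length w using Nat.strong_induction_on generalizing w s with
  | h n ih =>
    by_cases hw : w = 1
    · rw [hw, act_one]
      exact R.root_mem_cone s
    · obtain ⟨t, ht⟩ := cs.exists_rightDescent_of_ne_one hw
      have hst : s ≠ t := by
        rintro rfl
        exact lt_asymm h ht
      obtain ⟨v, k, rfl, hvw, hvs, hvt, hk⟩ := exists_alternatingWord_factorization h ht
      obtain ⟨p, q, hp, hq, hpq⟩ := R.exists_act_alternatingWord hst hk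
      rw [act_mul, hpq, map_add, map_smul, map_smul]
      exact add_mem (smul_mem_nonnegSpan hp (ih _ (hn ▸ hvw) v s hvs rfl))
        (smul_mem_nonnegSpan hq (ih _ (hn ▸ hvw) v t hvt rfl))

theorem neg_act_root_mem_cone (w : W) (s : S) (h : cs.length (w * cs.simple s) < cs.length w) :
    -R.act w (R.root s) ∈ R.cone := by
  have := R.act_root_mem_cone (w * cs.simple s) s (by
    rwa [mul_assoc, cs.simple_mul_simple_self, mul_one])
  rwa [act_mul, act_simple_root, map_neg] at this

theorem mem_cone_or_neg_mem_cone (w : W) (s : S) :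
    R.act w (R.root s) ∈ R.cone ∨ -R.act w (R.root s) ∈ R.cone := by
  rcases lt_or_gt_of_ne (cs.length_mul_simple_ne w s) with h | h
  · exact Or.inr (R.neg_act_root_mem_cone w s h)
  · exact Or.inl (R.act_root_mem_cone w s h)

theorem exists_neg_act_root_mem_cone {w : W} (hw : w ≠ 1) :
    ∃ s, -R.act w (R.root s) ∈ R.cone :=
  (cs.exists_rightDescent_of_ne_one hw).imp fun s hs => R.neg_act_root_mem_cone w s hs

theorem eq_one_of_forall_mem_cone {w : W} (h : ∀ s, R.act w (R.root s) ∈ R.cone) : w = 1 := by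
  by_contra hw
  obtain ⟨s, hs⟩ := R.exists_neg_act_root_mem_cone hw
  exact R.act_root_ne_zero w s (R.eq_zero_of_neg_mem_cone (h s) hs)

/-! ### Faithfulness, and reflections versus roots -/

theorem act_injective : Function.Injective R.act := by
  rw [injective_iff_map_eq_one]
  intro w hw
  refine R.eq_one_of_forall_mem_cone fun s => ?_
  rw [hw]
  exact R.root_mem_cone s

/-- The action of a conjugate of a simple reflection. -/
theorem act_conj_simple (w : W) (s : S) (x : V) :
    R.act (w * cs.simple s * w⁻¹) x =
      x - (2 * R.coroot s (R.act w⁻¹ x)) • R.act w (R.root s) := by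
  rw [act_mul, act_mul, act_simple, map_sub, map_smul, act_act_inv]

/-- The roots whose sign is changed by a simple reflection are multiples of the simple root. -/
theorem exists_eq_smul_root {x : V} {t : S} (hx : x ∈ R.cone) {k : ℝ}
    (h : -(x + k • R.root t) ∈ R.cone) : ∃ a : ℝ, 0 ≤ a ∧ x = a • R.root t :=
  exists_smul_eq_of_add_eq_smul R.zero_notMem ⟨t, rfl⟩ (R.root_notMem t) hx h (k := -k) (by
    rw [neg_smul]; abel)

/-- A root alone does not determine a reflection, as the coroots might differ. But the product of
the two reflections fixes `root t` and moves every simple root by a multiple of `root t`; so it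
makes no simple root negative and is `1`. -/
theorem conj_simple_eq_simple {w : W} {s t : S} {c : ℝ}
    (h : R.act w (R.root s) = c • R.root t) : w * cs.simple s * w⁻¹ = cs.simple t := by
  have hfix : R.act (w * cs.simple s * w⁻¹ * cs.simple t) (R.root t) = R.root t := by
    have hc : c ≠ 0 := by
      rintro rfl
      exact R.act_root_ne_zero w s (by rw [h, zero_smul])
    have ht : R.root t = c⁻¹ • R.act w (R.root s) := by
      rw [h, smul_smul, inv_mul_cancel₀ hc, one_smul]
    rw [act_mul, act_simple_root, map_neg]
    conv_lhs => rw [ht]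
    rw [map_smul, act_mul, act_inv_act, act_mul, act_simple_root, map_neg, smul_neg, neg_neg, ← ht]
  have hone : w * cs.simple s * w⁻¹ * cs.simple t = 1 := by
    refine R.eq_one_of_forall_mem_cone fun r => ?_
    rcases R.mem_cone_or_neg_mem_cone (w * cs.simple s * w⁻¹ * cs.simple t) r with hr | hr
    · exact hr
    · have hshift : ∃ k : ℝ, R.act (w * cs.simple s * w⁻¹ * cs.simple t) (R.root r) =
          R.root r + k • R.root t := by
        rw [act_mul, act_conj_simple, h, act_simple]
        generalize 2 * R.coroot s _ = d
        refine ⟨-(2 * R.coroot t (R.root r)) - d * c, ?_⟩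
        rw [sub_smul, smul_smul, neg_smul]
        abel
      obtain ⟨k, hk⟩ := hshift
      rw [hk] at hr
      obtain ⟨a, ha, har⟩ := R.exists_eq_smul_root (R.root_mem_cone r) hr
      rw [har, map_smul, hfix]
      exact smul_mem_nonnegSpan ha (R.root_mem_cone t)
  rw [← mul_one (w * cs.simple s * w⁻¹), ← cs.simple_mul_simple_self t, ← mul_assoc, hone, one_mul]

theorem conj_simple_eq_conj_simple {w v : W} {s t : S} {c : ℝ}
    (h : R.act w (R.root s) = c • R.act v (R.root t)) :
    w * cs.simple s * w⁻¹ = v * cs.simple t * v⁻¹ := by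
  have := R.conj_simple_eq_simple (w := v⁻¹ * w) (s := s) (t := t) (c := c) (by
    rw [act_mul, h, map_smul, act_inv_act])
  rw [← this]
  group

/-- The `-1` eigenspace of a reflection is the line through its root. -/
theorem exists_act_root_eq_smul {w v : W} {s t : S}
    (h : w * cs.simple s * w⁻¹ = v * cs.simple t * v⁻¹) :
    ∃ c : ℝ, c ≠ 0 ∧ R.act w (R.root s) = c • R.act v (R.root t) := by
  have h1 : R.act (v * cs.simple t * v⁻¹) (R.act w (R.root s)) = -R.act w (R.root s) := by
    rw [← h, act_mul, act_mul, act_inv_act, act_simple_root, map_neg]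
  rw [act_conj_simple] at h1
  have h2 : (2 : ℝ) • R.act w (R.root s) =
      (2 * R.coroot t (R.act v⁻¹ (R.act w (R.root s)))) • R.act v (R.root t) := by
    rw [two_smul, ← sub_eq_zero, ← sub_eq_zero.2 h1]
    abel
  have h3 : R.act w (R.root s) =
      R.coroot t (R.act v⁻¹ (R.act w (R.root s))) • R.act v (R.root t) := by
    rw [mul_smul] at h2
    exact smul_right_injective V (two_ne_zero' ℝ) h2
  refine ⟨_, fun h0 => ?_, h3⟩
  rw [h0, zero_smul] at h3
  exact R.act_root_ne_zero w s h3

/-- Deleting a letter: if `w` makes a positive root negative, the corresponding reflection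
shortens `w`. -/
theorem length_mul_conj_lt_of_neg_mem {w v : W} {s : S} (hv : R.act v (R.root s) ∈ R.cone)
    (hw : -R.act w (R.act v (R.root s)) ∈ R.cone) :
    cs.length (w * (v * cs.simple s * v⁻¹)) < cs.length w := by
  induction hn : cs.length w generalizing w v with
  | zero =>
    rw [cs.length_eq_zero_iff] at hn
    rw [hn, act_one] at hw
    exact absurd (R.eq_zero_of_neg_mem_cone hv hw) (R.act_root_ne_zero v s)
  | succ n ih =>
    obtain ⟨t, ht⟩ := cs.exists_rightDescent_of_ne_one (w := w) (by
      rintro rfl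
      simp at hn)
    rw [cs.isRightDescent_iff] at ht
    by_cases hpos : R.act (cs.simple t * v) (R.root s) ∈ R.cone
    · have := ih (w := w * cs.simple t) hpos (by
        -- Restoring the letter `t` at the end costs at most one, which the strict drop for `w *
        -- cs.simple t` absorbs.
        rwa [← act_mul, ← mul_assoc, cs.simple_mul_simple_cancel_right, act_mul]) (by lia)
      have heq : w * (v * cs.simple s * v⁻¹) = w * cs.simple t *
          (cs.simple t * v * cs.simple s * (cs.simple t * v)⁻¹) * cs.simple t := by
        simp [mul_assoc]
      rw [heq]
      rcases cs.length_mul_simple (w * cs.simple t *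
        (cs.simple t * v * cs.simple s * (cs.simple t * v)⁻¹)) t with h | h <;> lia
    · have hneg := (R.mem_cone_or_neg_mem_cone (cs.simple t * v) s).resolve_left hpos
      rw [act_mul, act_simple, sub_eq_add_neg, ← neg_smul] at hneg
      obtain ⟨a, -, ha⟩ := R.exists_eq_smul_root hv hneg
      rw [R.conj_simple_eq_simple ha]
      lia

/-- For the forward direction, if `w` keeps the root positive, then `w` times the reflection makes
it negative, so multiplying by the reflection again would shorten it. -/
theorem length_mul_conj_lt_iff {w v : W} {s : S} (hv : R.act v (R.root s) ∈ R.cone) :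
    cs.length (w * (v * cs.simple s * v⁻¹)) < cs.length w ↔
      -R.act w (R.act v (R.root s)) ∈ R.cone := by
  refine ⟨fun h => ?_, R.length_mul_conj_lt_of_neg_mem hv⟩
  rw [← act_mul]
  refine (R.mem_cone_or_neg_mem_cone (w * v) s).resolve_left fun hpos => ?_
  have h1 := R.length_mul_conj_lt_of_neg_mem (w := w * (v * cs.simple s * v⁻¹)) hv (by
    rw [act_mul, act_mul, act_inv_act, act_mul, act_simple_root, map_neg, map_neg, neg_neg,
      ← act_mul]
    exact hpos)
  have h2 : w * (v * cs.simple s * v⁻¹) * (v * cs.simple s * v⁻¹) = w := by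
    simp [mul_assoc]
  rw [h2] at h1
  exact lt_asymm h h1

end RootRep

/-! ### Roots, reflections and the map `φ` of a Coxeter datum -/

namespace CoxeterDatum

section

variable {S V₁ V₂ : Type*} [AddCommGroup V₁] [Module ℝ V₁] [AddCommGroup V₂] [Module ℝ V₂]
variable (C : CoxeterDatum S V₁ V₂)

theorem matrix_apply_of_ne {s t : S} (hst : s ≠ t) :
    C.matrix s t = cosOrder (C.pair (C.α s) (C.β t) * C.pair (C.α t) (C.β s)) :=
  if_neg hst

theorem pair_mul_pair_of_matrix_ne_zero {s t : S} (hst : s ≠ t) (h : C.matrix s t ≠ 0) :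
    C.pair (C.α s) (C.β t) * C.pair (C.α t) (C.β s) = Real.cos (Real.pi / C.matrix s t) ^ 2 := by
  rw [C.matrix_apply_of_ne hst] at h ⊢
  exact (cosOrder_spec h).2

theorem one_le_pair_mul_pair_of_matrix_eq_zero {s t : S} (hst : s ≠ t) (h : C.matrix s t = 0) :
    1 ≤ C.pair (C.α s) (C.β t) * C.pair (C.α t) (C.β s) := by
  refine (C.D5 s t).resolve_left fun hex => ?_
  rw [C.matrix_apply_of_ne hst, cosOrder, dif_pos hex] at h
  have := hex.choose_spec.1
  lia

/-- The action of `W` on `V₁`, as a representation with simple roots `α s`. -/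
noncomputable def rep₁ : RootRep C.system V₁ where
  act := C.act₁
  root := C.α
  coroot s := C.pair.flip (C.β s)
  coroot_root_self := C.D1
  act_simple s x := by rw [C.act₁_simple, C.ρ₁_apply]; rfl
  zero_notMem := C.D2_i.1
  root_notMem s := (C.D2_ii s).1
  coroot_nonpos s t hst := (C.D3 s t hst).1
  coroot_eq_zero s t := (C.D4 s t).1
  coroot_mul_of_ne_zero _ _ := C.pair_mul_pair_of_matrix_ne_zero
  coroot_mul_of_eq_zero _ _ := C.one_le_pair_mul_pair_of_matrix_eq_zero

/-- The action of `W` on `V₂`, as a representation with simple roots `β s`. -/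
noncomputable def rep₂ : RootRep C.system V₂ where
  act := C.act₂
  root := C.β
  coroot s := C.pair (C.α s)
  coroot_root_self := C.D1
  act_simple s x := by rw [C.act₂_simple, C.ρ₂_apply]
  zero_notMem := C.D2_i.2
  root_notMem s := (C.D2_ii s).2
  coroot_nonpos s t hst := (C.D3 s t hst).2
  coroot_eq_zero s t := (C.D4 s t).2
  coroot_mul_of_ne_zero s t hst h := by
    rw [mul_comm]; exact C.pair_mul_pair_of_matrix_ne_zero hst h
  coroot_mul_of_eq_zero s t hst h := by
    rw [mul_comm]; exact C.one_le_pair_mul_pair_of_matrix_eq_zero hst h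

theorem act₁_mul (w v : C.W) (x : V₁) : C.act₁ (w * v) x = C.act₁ w (C.act₁ v x) :=
  C.rep₁.act_mul w v x

theorem act₁_act₁_inv (w : C.W) (x : V₁) : C.act₁ w (C.act₁ w⁻¹ x) = x :=
  C.rep₁.act_act_inv w x

theorem pair_act (w : C.W) (x : V₁) (y : V₂) :
    C.pair (C.act₁ w x) (C.act₂ w y) = C.pair x y := by
  induction w using C.system.simple_induction generalizing x y with
  | simple s =>
    rw [C.act₁_simple, C.act₂_simple, C.ρ₁_apply, C.ρ₂_apply]
    simp only [map_sub, map_smul, LinearMap.sub_apply, LinearMap.smul_apply, smul_eq_mul, C.D1]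
    ring
  | one => simp
  | mul w v hw hv =>
    rw [map_mul, map_mul]
    exact (hw _ _).trans (hv _ _)

theorem refl₁_act_α (w : C.W) (s : S) :
    C.refl₁ (C.act₁ w (C.α s)) = w * C.system.simple s * w⁻¹ := by
  have h : ∃ p : C.W × S, C.act₁ p.1 (C.α p.2) = C.act₁ w (C.α s) := ⟨(w, s), rfl⟩
  rw [refl₁, dif_pos h]
  exact C.rep₁.conj_simple_eq_conj_simple (c := 1) (by rw [one_smul]; exact h.choose_spec)

theorem refl₂_act_β (w : C.W) (s : S) :
    C.refl₂ (C.act₂ w (C.β s)) = w * C.system.simple s * w⁻¹ := by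
  have h : ∃ p : C.W × S, C.act₂ p.1 (C.β p.2) = C.act₂ w (C.β s) := ⟨(w, s), rfl⟩
  rw [refl₂, dif_pos h]
  exact C.rep₂.conj_simple_eq_conj_simple (c := 1) (by rw [one_smul]; exact h.choose_spec)

/-- This makes `φ` well defined. Equal roots in `V₁` give equal reflections, hence proportional
roots in `V₂`; the scalar is `1` because the invariant pairing of a root with its partner is `1`. -/
theorem act₂_β_eq_of_act₁_α_eq {w v : C.W} {s t : S}
    (h : C.act₁ w (C.α s) = C.act₁ v (C.α t)) : C.act₂ w (C.β s) = C.act₂ v (C.β t) := by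
  have hconj := C.rep₁.conj_simple_eq_conj_simple (w := w) (v := v) (s := s) (t := t) (c := 1)
    (by rw [one_smul]; exact h)
  obtain ⟨c, -, hc⟩ := C.rep₂.exists_act_root_eq_smul hconj
  change C.act₂ w (C.β s) = c • C.act₂ v (C.β t) at hc
  have h1 : C.pair (C.act₁ w (C.α s)) (C.act₂ w (C.β s)) = 1 := by rw [C.pair_act, C.D1]
  rw [hc, map_smul, h, C.pair_act, C.D1, smul_eq_mul, mul_one] at h1
  rw [hc, h1, one_smul]

theorem φ_act_α (w : C.W) (s : S) : C.φ (C.act₁ w (C.α s)) = C.act₂ w (C.β s) := by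
  have h : ∃ p : C.W × S, C.act₁ p.1 (C.α p.2) = C.act₁ w (C.α s) := ⟨(w, s), rfl⟩
  rw [φ, dif_pos h]
  exact C.act₂_β_eq_of_act₁_α_eq h.choose_spec

theorem act₁_mem_Φ₁ (w : C.W) {x : V₁} (hx : x ∈ C.Φ₁) : C.act₁ w x ∈ C.Φ₁ := by
  obtain ⟨⟨v, s⟩, rfl⟩ := hx
  exact ⟨(w * v, s), C.act₁_mul w v _⟩

theorem refl₁_act (w : C.W) {x : V₁} (hx : x ∈ C.Φ₁) :
    C.refl₁ (C.act₁ w x) = w * C.refl₁ x * w⁻¹ := by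
  obtain ⟨⟨v, s⟩, rfl⟩ := hx
  dsimp only
  rw [← C.act₁_mul, refl₁_act_α, refl₁_act_α]
  group

theorem refl₁_mem_T {x : V₁} (hx : x ∈ C.Φ₁) : C.refl₁ x ∈ C.T := by
  obtain ⟨⟨v, s⟩, rfl⟩ := hx
  dsimp only
  rw [refl₁_act_α]
  exact ⟨v, s, rfl⟩

theorem refl₁_ne_one {x : V₁} (hx : x ∈ C.Φ₁) : C.refl₁ x ≠ 1 := by
  intro h
  have := (C.refl₁_mem_T hx).odd_length
  rw [h] at this
  simp at this

theorem refl₂_φ {x : V₁} (hx : x ∈ C.Φ₁) : C.refl₂ (C.φ x) = C.refl₁ x := by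
  obtain ⟨⟨v, s⟩, rfl⟩ := hx
  dsimp only
  rw [refl₁_act_α, φ_act_α, refl₂_act_β]

theorem pair_φ_self {x : V₁} (hx : x ∈ C.Φ₁) : C.pair x (C.φ x) = 1 := by
  obtain ⟨⟨v, s⟩, rfl⟩ := hx
  dsimp only
  rw [φ_act_α, C.pair_act, C.D1]

theorem act₁_refl₁ {x : V₁} (hx : x ∈ C.Φ₁) (v : V₁) :
    C.act₁ (C.refl₁ x) v = v - (2 * C.pair v (C.φ x)) • x := by
  obtain ⟨⟨w, s⟩, rfl⟩ := hx
  dsimp only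
  rw [refl₁_act_α, φ_act_α]
  refine (C.rep₁.act_conj_simple w s v).trans ?_
  change v - (2 * C.pair (C.act₁ w⁻¹ v) (C.β s)) • C.act₁ w (C.α s) = _
  rw [← C.pair_act w, C.act₁_act₁_inv]

theorem act₁_refl₁_self {x : V₁} (hx : x ∈ C.Φ₁) : C.act₁ (C.refl₁ x) x = -x := by
  rw [C.act₁_refl₁ hx, C.pair_φ_self hx, mul_one, two_smul]
  abel

theorem neg_mem_Φ₁ {x : V₁} (hx : x ∈ C.Φ₁) : -x ∈ C.Φ₁ := by
  rw [← C.act₁_refl₁_self hx]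
  exact C.act₁_mem_Φ₁ _ hx

theorem refl₁_neg {x : V₁} (hx : x ∈ C.Φ₁) : C.refl₁ (-x) = C.refl₁ x := by
  rw [← C.act₁_refl₁_self hx, C.refl₁_act _ hx]
  group

theorem ne_zero_of_mem_Φ₁ {x : V₁} (hx : x ∈ C.Φ₁) : x ≠ 0 := by
  rintro rfl
  simpa using C.pair_φ_self hx

theorem exists_eq_smul_of_refl₁_eq {x y : V₁} (hx : x ∈ C.Φ₁) (hy : y ∈ C.Φ₁)
    (h : C.refl₁ x = C.refl₁ y) : ∃ c : ℝ, c ≠ 0 ∧ x = c • y := by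
  obtain ⟨⟨v, s⟩, rfl⟩ := hx
  obtain ⟨⟨w, t⟩, rfl⟩ := hy
  dsimp only at h ⊢
  rw [refl₁_act_α, refl₁_act_α] at h
  exact C.rep₁.exists_act_root_eq_smul h

theorem exists_eq_smul_of_refl₂_eq {x y : V₂} (hx : x ∈ C.Φ₂) (hy : y ∈ C.Φ₂)
    (h : C.refl₂ x = C.refl₂ y) : ∃ c : ℝ, c ≠ 0 ∧ x = c • y := by
  obtain ⟨⟨v, s⟩, rfl⟩ := hx
  obtain ⟨⟨w, t⟩, rfl⟩ := hy
  dsimp only at h ⊢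
  rw [refl₂_act_β, refl₂_act_β] at h
  exact C.rep₂.exists_act_root_eq_smul h

theorem refl₁_eq_of_eq_smul {x y : V₁} (hx : x ∈ C.Φ₁) (hy : y ∈ C.Φ₁) {c : ℝ}
    (h : x = c • y) : C.refl₁ x = C.refl₁ y := by
  obtain ⟨⟨v, s⟩, rfl⟩ := hx
  obtain ⟨⟨w, t⟩, rfl⟩ := hy
  dsimp only at h ⊢
  rw [refl₁_act_α, refl₁_act_α]
  exact C.rep₁.conj_simple_eq_conj_simple h

/-- If `r_y` fixes `x`, then `r_x` and `r_y` commute, so `r_x y` is a multiple of `y`. Pairing with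
`φ y` shows that the scalar is `1`. -/
theorem pair_φ_eq_zero_of_pair_φ_eq_zero {x y : V₁} (hx : x ∈ C.Φ₁) (hy : y ∈ C.Φ₁)
    (h : C.pair x (C.φ y) = 0) : C.pair y (C.φ x) = 0 := by
  have h1 : C.act₁ (C.refl₁ y) x = x := by
    rw [C.act₁_refl₁ hy, h, mul_zero, zero_smul, sub_zero]
  have h2 : C.refl₁ y * C.refl₁ x * (C.refl₁ y)⁻¹ = C.refl₁ x := by
    rw [← C.refl₁_act _ hx, h1]
  have h3 : C.refl₁ (C.act₁ (C.refl₁ x) y) = C.refl₁ y := by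
    rw [C.refl₁_act _ hy, mul_inv_eq_iff_eq_mul]
    exact (mul_inv_eq_iff_eq_mul.1 h2).symm
  obtain ⟨c, -, hc⟩ := C.exists_eq_smul_of_refl₁_eq (C.act₁_mem_Φ₁ _ hy) hy h3
  rw [C.act₁_refl₁ hx] at hc
  have h4 := congrArg (fun v => C.pair v (C.φ y)) hc
  simp only [map_sub, map_smul, LinearMap.sub_apply, LinearMap.smul_apply, h,
    C.pair_φ_self hy, smul_eq_mul, mul_zero, sub_zero, mul_one] at h4
  rw [← h4, one_smul, sub_eq_self, smul_eq_zero] at hc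
  have := hc.resolve_right (C.ne_zero_of_mem_Φ₁ hx)
  linarith

theorem mem_Φ₁pos_iff {x : V₁} :
    x ∈ C.Φ₁pos ↔ x ∈ C.Φ₁ ∧ x ∈ nonnegSpan (Set.range C.α) :=
  and_congr_right fun hx => ⟨mem_nonnegSpan_of_mem_PLC, fun h =>
    mem_PLC_of_mem_nonnegSpan h (C.ne_zero_of_mem_Φ₁ hx)⟩

theorem mem_Φ₁pos_or_neg_mem_Φ₁pos {x : V₁} (hx : x ∈ C.Φ₁) : x ∈ C.Φ₁pos ∨ -x ∈ C.Φ₁pos := by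
  obtain ⟨⟨w, s⟩, rfl⟩ := id hx
  exact (C.rep₁.mem_cone_or_neg_mem_cone w s).imp (fun h => C.mem_Φ₁pos_iff.2 ⟨hx, h⟩)
    (fun h => C.mem_Φ₁pos_iff.2 ⟨C.neg_mem_Φ₁ hx, h⟩)

theorem exists_mem_Φ₁pos_refl₁_eq {t : C.W} (ht : t ∈ C.T) : ∃ z ∈ C.Φ₁pos, C.refl₁ z = t := by
  obtain ⟨w, s, rfl⟩ := ht
  have hz : C.act₁ w (C.α s) ∈ C.Φ₁ := ⟨(w, s), rfl⟩
  rcases C.mem_Φ₁pos_or_neg_mem_Φ₁pos hz with h | h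
  · exact ⟨_, h, C.refl₁_act_α w s⟩
  · exact ⟨_, h, by rw [C.refl₁_neg hz, C.refl₁_act_α]⟩

theorem refl₁_mem_Nbar_iff {z : V₁} (hz : z ∈ C.Φ₁pos) (w : C.W) :
    C.refl₁ z ∈ C.Nbar w ↔ -C.act₁ w z ∈ nonnegSpan (Set.range C.α) := by
  have hT := C.refl₁_mem_T hz.1
  obtain ⟨hΦ, hpos⟩ := C.mem_Φ₁pos_iff.1 hz
  obtain ⟨⟨v, s⟩, rfl⟩ := hΦ
  dsimp only at *
  rw [refl₁_act_α] at hT ⊢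
  exact (and_iff_right hT).trans (C.rep₁.length_mul_conj_lt_iff hpos)

end

/-! ### The datum on `Δ₁'` and the canonical generators -/

section Subdatum

variable {S V₁ V₂ : Type*} [AddCommGroup V₁] [Module ℝ V₁] [AddCommGroup V₂] [Module ℝ V₂]
variable {C : CoxeterDatum S V₁ V₂} {A : Set V₁}

theorem nonnegSpan_le_of_subset_Φ₁pos (hA : A ⊆ C.Φ₁pos) :
    nonnegSpan A ≤ nonnegSpan (Set.range C.α) :=
  Submodule.span_le.2 fun _ hx => (C.mem_Φ₁pos_iff.1 (hA hx)).2

theorem zero_notMem_PLC_of_subset_Φ₁pos (hA : A ⊆ C.Φ₁pos) : 0 ∉ PLC A := by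
  intro h
  obtain ⟨a, ha, r, hr, y, hy, h0⟩ := exists_eq_smul_add_of_mem_PLC h
  have hle := nonnegSpan_le_of_subset_Φ₁pos hA
  have hra : r • a = 0 := by
    refine eq_zero_of_neg_mem_nonnegSpan C.D2_i.1
      (smul_mem_nonnegSpan hr.le (hle (Submodule.subset_span ha))) ?_
    rw [neg_eq_of_add_eq_zero_right h0.symm]
    exact hle hy
  exact C.ne_zero_of_mem_Φ₁ (hA ha).1 ((smul_eq_zero.1 hra).resolve_left hr.ne')

theorem zero_notMem_PLC_of_subset_Φ₂pos {B : Set V₂} (hB : B ⊆ C.Φ₂pos) : 0 ∉ PLC B := by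
  intro h
  obtain ⟨a, ha, r, hr, y, hy, h0⟩ := exists_eq_smul_add_of_mem_PLC h
  have hle : nonnegSpan B ≤ nonnegSpan (Set.range C.β) :=
    Submodule.span_le.2 fun _ hx => mem_nonnegSpan_of_mem_PLC (hB hx).2
  have hra : r • a = 0 := by
    refine eq_zero_of_neg_mem_nonnegSpan C.D2_i.2
      (smul_mem_nonnegSpan hr.le (hle (Submodule.subset_span ha))) ?_
    rw [neg_eq_of_add_eq_zero_right h0.symm]
    exact hle hy
  have ha0 := (smul_eq_zero.1 hra).resolve_left hr.ne'
  exact C.D2_i.2 (ha0 ▸ (hB ha).2)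

theorem linearMap_nonpos_of_mem_nonnegSpan {V : Type*} [AddCommGroup V] [Module ℝ V] {B : Set V}
    (f : V →ₗ[ℝ] ℝ) (hf : ∀ b ∈ B, f b ≤ 0) {x : V} (hx : x ∈ nonnegSpan B) : f x ≤ 0 := by
  induction hx using Submodule.span_induction with
  | mem b hb => exact hf b hb
  | zero => simp
  | add x y _ _ hx hy => rw [map_add]; exact add_nonpos hx hy
  | smul r x _ hx =>
    rw [NNReal.smul_def, map_smul, smul_eq_mul]
    exact mul_nonpos_of_nonneg_of_nonpos r.2 hx

/-- If the reflections agree, then `x = c • y` with `c = ⟨x, φ y⟩ ≤ 0`, which is impossible for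
positive roots. -/
theorem refl₁_ne_of_ne (hA : A ⊆ C.Φ₁pos)
    (A2 : ∀ x ∈ A, ∀ x' ∈ A, x ≠ x' → C.pair x (C.φ x') ≤ 0) {x y : V₁} (hx : x ∈ A) (hy : y ∈ A)
    (hxy : x ≠ y) : C.refl₁ x ≠ C.refl₁ y := by
  intro h
  obtain ⟨c, hc, rfl⟩ := C.exists_eq_smul_of_refl₁_eq (hA hx).1 (hA hy).1 h
  have h1 := A2 _ hx _ hy hxy
  rw [map_smul, LinearMap.smul_apply, C.pair_φ_self (hA hy).1, smul_eq_mul, mul_one] at h1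
  refine C.ne_zero_of_mem_Φ₁ (hA hx).1 (eq_zero_of_neg_mem_nonnegSpan C.D2_i.1
    (C.mem_Φ₁pos_iff.1 (hA hx)).2 ?_)
  rw [← neg_smul]
  exact smul_mem_nonnegSpan (by linarith) (C.mem_Φ₁pos_iff.1 (hA hy)).2

/-- A set of positive roots whose pairings satisfy the conditions for simple roots is the set of
simple roots of a Coxeter datum in the same pair of spaces. -/
noncomputable def subdatum (C : CoxeterDatum S V₁ V₂) (A : Set V₁) (hA : A ⊆ C.Φ₁pos)
    (hφA : C.φ '' A ⊆ C.Φ₂pos)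
    (A2 : ∀ x ∈ A, ∀ x' ∈ A, x ≠ x' → C.pair x (C.φ x') ≤ 0)
    (A3 : ∀ x ∈ A, ∀ x' ∈ A, C.refl₁ x ≠ C.refl₁ x' →
      (∃ m : ℕ, 2 ≤ m ∧
        C.pair x (C.φ x') * C.pair x' (C.φ x) = Real.cos (Real.pi / m) ^ 2) ∨
      1 ≤ C.pair x (C.φ x') * C.pair x' (C.φ x)) :
    CoxeterDatum A V₁ V₂ where
  pair := C.pair
  α := fun x => x
  β := fun x => C.φ x
  α_injective := Subtype.val_injective
  β_injective := by
    intro x y hxy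
    by_contra hne
    have h := A2 x x.2 y y.2 fun h => hne (Subtype.ext h)
    change C.φ x = C.φ y at hxy
    rw [← hxy, C.pair_φ_self (hA x.2).1] at h
    linarith
  D1 x := C.pair_φ_self (hA x.2).1
  D2_i := by
    constructor
    · rw [Subtype.range_coe]
      exact zero_notMem_PLC_of_subset_Φ₁pos hA
    · refine zero_notMem_PLC_of_subset_Φ₂pos (C := C) ?_
      rintro _ ⟨x, rfl⟩
      exact hφA ⟨x, x.2, rfl⟩
  D2_ii x := by
    constructor
    · intro h
      have := linearMap_nonpos_of_mem_nonnegSpan (C.pair.flip (C.φ x))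
        (B := Set.range (fun y : A => (y : V₁)) \ {(x : V₁)}) (by
          rintro _ ⟨⟨y, rfl⟩, hy⟩
          exact A2 y y.2 x x.2 hy) (mem_nonnegSpan_of_mem_PLC h)
      rw [LinearMap.flip_apply, C.pair_φ_self (hA x.2).1] at this
      linarith
    · intro h
      have := linearMap_nonpos_of_mem_nonnegSpan (C.pair x)
        (B := Set.range (fun y : A => C.φ y) \ {C.φ x}) (by
          rintro _ ⟨⟨y, rfl⟩, hy⟩
          refine A2 x x.2 y y.2 fun hxy => hy ?_
          rw [Set.mem_singleton_iff, hxy]) (mem_nonnegSpan_of_mem_PLC h)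
      rw [C.pair_φ_self (hA x.2).1] at this
      linarith
  D3 x y hxy := by
    have hne : (x : V₁) ≠ y := fun h => hxy (Subtype.ext h)
    exact ⟨A2 x x.2 y y.2 hne, A2 y y.2 x x.2 hne.symm⟩
  D4 x y := ⟨C.pair_φ_eq_zero_of_pair_φ_eq_zero (hA x.2).1 (hA y.2).1,
    C.pair_φ_eq_zero_of_pair_φ_eq_zero (hA y.2).1 (hA x.2).1⟩
  D5 x y := by
    by_cases hxy : (x : V₁) = y
    · right
      rw [← hxy, C.pair_φ_self (hA x.2).1, one_mul]
    · exact A3 x x.2 y y.2 (refl₁_ne_of_ne hA A2 x.2 y.2 hxy)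

/-- A nontrivial element of the subgroup generated by the reflections in `A` makes some element of
`A` negative. -/
theorem exists_neg_act₁_mem_nonnegSpan (hA : A ⊆ C.Φ₁pos)
    (hφA : C.φ '' A ⊆ C.Φ₂pos)
    (A2 : ∀ x ∈ A, ∀ x' ∈ A, x ≠ x' → C.pair x (C.φ x') ≤ 0)
    (A3 : ∀ x ∈ A, ∀ x' ∈ A, C.refl₁ x ≠ C.refl₁ x' →
      (∃ m : ℕ, 2 ≤ m ∧
        C.pair x (C.φ x') * C.pair x' (C.φ x) = Real.cos (Real.pi / m) ^ 2) ∨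
      1 ≤ C.pair x (C.φ x') * C.pair x' (C.φ x))
    {w : C.W} (hw : w ∈ Subgroup.closure (C.refl₁ '' A)) (hw1 : w ≠ 1) :
    ∃ x ∈ A, -C.act₁ w x ∈ nonnegSpan A := by
  set D := C.subdatum A hA hφA A2 A3 with hD
  -- The groups of `C` and `D` are compared only through the operators on `V₁`: each generator of
  -- `W'` acts as a simple reflection of `D`.
  have hlift : ∃ v : D.W, D.act₁ v = C.act₁ w := by
    have hle : Subgroup.closure (C.refl₁ '' A) ≤ D.act₁.range.comap C.act₁ := by
      rw [Subgroup.closure_le]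
      rintro _ ⟨x, hx, rfl⟩
      refine ⟨D.system.simple ⟨x, hx⟩, ?_⟩
      ext v
      rw [D.act₁_simple, D.ρ₁_apply, C.act₁_refl₁ (hA hx).1]
      rfl
    exact hle hw
  obtain ⟨v, hv⟩ := hlift
  have hv1 : v ≠ 1 := by
    rintro rfl
    rw [map_one, eq_comm] at hv
    exact hw1 (C.rep₁.act_injective (hv.trans (map_one C.act₁).symm))
  obtain ⟨x, hx⟩ := D.rep₁.exists_neg_act_root_mem_cone hv1
  refine ⟨x, x.2, ?_⟩
  change -D.act₁ v (x : V₁) ∈ nonnegSpan (Set.range (fun x : A => (x : V₁))) at hx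
  rwa [Subtype.range_coe, hv] at hx

/-- For `w = r_z` the hypothesis puts `-x + k • z` in the cone of `A`. If `k ≤ 0`, then `-x` would
be in the cone of simple roots; so `k > 0`, and adding `x` isolates `z`. -/
theorem mem_nonnegSpan_of_refl₁_mem_closure (hA : A ⊆ C.Φ₁pos)
    (hneg : ∀ w ∈ Subgroup.closure (C.refl₁ '' A), w ≠ 1 →
      ∃ x ∈ A, -C.act₁ w x ∈ nonnegSpan A) {z : V₁} (hz : z ∈ C.Φ₁pos)
    (hzA : C.refl₁ z ∈ Subgroup.closure (C.refl₁ '' A)) : z ∈ nonnegSpan A := by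
  have hle := nonnegSpan_le_of_subset_Φ₁pos hA
  obtain ⟨x, hx, hn⟩ := hneg _ hzA (C.refl₁_ne_one hz.1)
  rw [C.act₁_refl₁ hz.1] at hn
  have hxA : x ∈ nonnegSpan A := Submodule.subset_span hx
  generalize 2 * C.pair x (C.φ z) = k at hn
  rcases lt_or_ge 0 k with hk | hk
  · have : z = k⁻¹ • (x + -(x - k • z)) := by
      rw [neg_sub, add_sub_cancel, smul_smul, inv_mul_cancel₀ hk.ne', one_smul]
    rw [this]
    exact smul_mem_nonnegSpan (inv_nonneg.2 hk.le) (add_mem hxA hn)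
  · refine absurd (eq_zero_of_neg_mem_nonnegSpan C.D2_i.1 (hle hxA) ?_)
      (C.ne_zero_of_mem_Φ₁ (hA hx).1)
    have : -x = -(x - k • z) + (-k) • z := by
      rw [neg_smul]; abel
    rw [this]
    exact add_mem (hle hn)
      (smul_mem_nonnegSpan (by linarith) (C.mem_Φ₁pos_iff.1 hz).2)

theorem canonicalGenerators_closure_refl₁ (hA : A ⊆ C.Φ₁pos)
    (hA' : ∀ x ∈ A, x ∉ PLC (A \ {x}))
    (hneg : ∀ w ∈ Subgroup.closure (C.refl₁ '' A), w ≠ 1 →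
      ∃ x ∈ A, -C.act₁ w x ∈ nonnegSpan A) :
    C.canonicalGenerators (Subgroup.closure (C.refl₁ '' A)) = C.refl₁ '' A := by
  have hle := nonnegSpan_le_of_subset_Φ₁pos hA
  have hsub : C.refl₁ '' A ⊆ Subgroup.closure (C.refl₁ '' A) := Subgroup.subset_closure
  apply Set.Subset.antisymm
  · rintro t ⟨hT, ht⟩
    have htW : t ∈ Subgroup.closure (C.refl₁ '' A) := by
      have : t ∈ C.Nbar t ∩ (Subgroup.closure (C.refl₁ '' A) : Set C.W) := by simp [ht]
      exact this.2
    have ht1 : t ≠ 1 := by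
      rintro rfl
      simpa using CoxeterSystem.IsReflection.odd_length hT
    obtain ⟨x, hx, hn⟩ := hneg t htW ht1
    have : C.refl₁ x ∈ C.Nbar t ∩ (Subgroup.closure (C.refl₁ '' A) : Set C.W) :=
      ⟨(C.refl₁_mem_Nbar_iff (hA hx) t).2 (hle hn), hsub ⟨x, hx, rfl⟩⟩
    rw [ht] at this
    exact ⟨x, hx, this⟩
  · rintro _ ⟨x, hx, rfl⟩
    refine ⟨C.refl₁_mem_T (hA hx).1, Set.Subset.antisymm ?_ ?_⟩
    · rintro t ⟨htN, htW⟩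
      obtain ⟨z, hz, rfl⟩ := C.exists_mem_Φ₁pos_refl₁_eq htN.1
      have hn := (C.refl₁_mem_Nbar_iff hz _).1 htN
      have hzA := mem_nonnegSpan_of_refl₁_mem_closure hA hneg hz htW
      have hact := C.act₁_mem_Φ₁ (C.refl₁ x) hz.1
      -- The positive root `-r_x z` also has its reflection in `W'`, as this is a conjugate of `r_z`
      -- by `r_x`.
      have hnA := mem_nonnegSpan_of_refl₁_mem_closure hA hneg
        (C.mem_Φ₁pos_iff.2 ⟨C.neg_mem_Φ₁ hact, hn⟩) (by
          rw [C.refl₁_neg hact, C.refl₁_act _ hz.1]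
          exact mul_mem (mul_mem (hsub ⟨x, hx, rfl⟩) htW) (inv_mem (hsub ⟨x, hx, rfl⟩)))
      obtain ⟨c, -, hc⟩ := exists_smul_eq_of_add_eq_smul (zero_notMem_PLC_of_subset_Φ₁pos hA) hx
        (hA' x hx) hzA hnA (k := 2 * C.pair z (C.φ x)) (by
          rw [C.act₁_refl₁ (hA hx).1, neg_sub, add_sub_cancel])
      exact C.refl₁_eq_of_eq_smul hz.1 (hA hx).1 hc
    · rintro _ rfl
      refine ⟨(C.refl₁_mem_Nbar_iff (hA hx) _).2 ?_, hsub ⟨x, hx, rfl⟩⟩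
      rw [C.act₁_refl₁_self (hA hx).1, neg_neg]
      exact (C.mem_Φ₁pos_iff.1 (hA hx)).2

theorem isReflectionSubgroup_closure (hA : A ⊆ C.Φ₁) :
    C.IsReflectionSubgroup (Subgroup.closure (C.refl₁ '' A)) := by
  apply le_antisymm
  · rw [Subgroup.closure_le]
    rintro _ ⟨x, hx, rfl⟩
    exact Subgroup.subset_closure
      ⟨Subgroup.subset_closure ⟨x, hx, rfl⟩, C.refl₁_mem_T (hA hx)⟩
  · rw [Subgroup.closure_le]
    exact Set.inter_subset_left

theorem setOf_smul_eq {V : Type*} [AddCommGroup V] [Module ℝ V] (P : Set V) {x y : V} {c : ℝ}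
    (hc : c ≠ 0) (h : x = c • y) :
    {z | z ∈ P ∧ ∃ d : ℝ, d ≠ 0 ∧ z = d • x} = {z | z ∈ P ∧ ∃ d : ℝ, d ≠ 0 ∧ z = d • y} := by
  subst h
  ext z
  refine and_congr_right fun _ => ⟨?_, ?_⟩
  · rintro ⟨d, hd, rfl⟩
    exact ⟨d * c, mul_ne_zero hd hc, smul_smul d c y⟩
  · rintro ⟨d, hd, rfl⟩
    exact ⟨d / c, div_ne_zero hd hc, by rw [smul_smul, div_mul_cancel₀ d hc]⟩

/-- Equality holds only up to scalars: `B` may contain several positive multiples of one root, all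
with the same reflection. -/
theorem hat₁_eq_of_subset {B : Set V₁} (hAB : A ⊆ B) (hB : B ⊆ C.Φ₁)
    (h : ∀ y ∈ B, ∃ x ∈ A, C.refl₁ x = C.refl₁ y) : C.hat₁ A = C.hat₁ B := by
  refine Set.Subset.antisymm (Set.image_mono hAB) ?_
  rintro _ ⟨y, hy, rfl⟩
  obtain ⟨x, hx, hxy⟩ := h y hy
  obtain ⟨c, hc, hcy⟩ := C.exists_eq_smul_of_refl₁_eq (hB (hAB hx)) (hB hy) hxy
  exact ⟨x, hx, setOf_smul_eq C.Φ₁ hc hcy⟩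

theorem hat₂_eq_of_subset {A B : Set V₂} (hAB : A ⊆ B) (hB : B ⊆ C.Φ₂)
    (h : ∀ y ∈ B, ∃ x ∈ A, C.refl₂ x = C.refl₂ y) : C.hat₂ A = C.hat₂ B := by
  refine Set.Subset.antisymm (Set.image_mono hAB) ?_
  rintro _ ⟨y, hy, rfl⟩
  obtain ⟨x, hx, hxy⟩ := h y hy
  obtain ⟨c, hc, hcy⟩ := C.exists_eq_smul_of_refl₂_eq (hB (hAB hx)) (hB hy) hxy
  exact ⟨x, hx, setOf_smul_eq C.Φ₂ hc hcy⟩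

end Subdatum

end CoxeterDatum

/-! ### The main theorem -/

theorem proposition3 {S V₁ V₂ : Type*} [AddCommGroup V₁] [Module ℝ V₁]
    [AddCommGroup V₂] [Module ℝ V₂] (C : CoxeterDatum S V₁ V₂)
    (Δ₁' : Set V₁) (Δ₂' : Set V₂) (hΔ₁' : Δ₁' ⊆ C.Φ₁pos) (hΔ₂' : Δ₂' ⊆ C.Φ₂pos)
    (A1 : C.φ '' Δ₁' = Δ₂')
    (A2 : ∀ x ∈ Δ₁', ∀ x' ∈ Δ₁', x ≠ x' → C.pair x (C.φ x') ≤ 0)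
    (A3 : ∀ x ∈ Δ₁', ∀ x' ∈ Δ₁', C.refl₁ x ≠ C.refl₁ x' →
      (∃ m : ℕ, 2 ≤ m ∧
        C.pair x (C.φ x') * C.pair x' (C.φ x) = Real.cos (Real.pi / m) ^ 2) ∨
      1 ≤ C.pair x (C.φ x') * C.pair x' (C.φ x)) :
    C.IsReflectionSubgroup (Subgroup.closure (C.refl₁ '' Δ₁')) ∧
    C.hat₁ Δ₁' = C.hat₁ (C.Δ₁ (Subgroup.closure (C.refl₁ '' Δ₁'))) ∧
    C.hat₂ Δ₂' = C.hat₂ (C.Δ₂ (Subgroup.closure (C.refl₁ '' Δ₁'))) := by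
  have hφ : C.φ '' Δ₁' ⊆ C.Φ₂pos := A1 ▸ hΔ₂'
  have hirr : ∀ x ∈ Δ₁', x ∉ PLC (Δ₁' \ {x}) := by
    intro x hx
    have := ((C.subdatum Δ₁' hΔ₁' hφ A2 A3).D2_ii ⟨x, hx⟩).1
    change x ∉ PLC (Set.range (fun y : Δ₁' => (y : V₁)) \ {x}) at this
    rwa [Subtype.range_coe] at this
  have hgen := CoxeterDatum.canonicalGenerators_closure_refl₁ hΔ₁' hirr fun w =>
    CoxeterDatum.exists_neg_act₁_mem_nonnegSpan hΔ₁' hφ A2 A3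
  refine ⟨CoxeterDatum.isReflectionSubgroup_closure fun x hx => (hΔ₁' hx).1,
    CoxeterDatum.hat₁_eq_of_subset ?_ ?_ ?_, CoxeterDatum.hat₂_eq_of_subset ?_ ?_ ?_⟩
  · intro x hx
    refine ⟨hΔ₁' hx, ?_⟩
    rw [hgen]
    exact ⟨x, hx, rfl⟩
  · exact fun y hy => hy.1.1
  · rintro y ⟨-, hy⟩
    rwa [hgen] at hy
  · intro y hy
    refine ⟨hΔ₂' hy, ?_⟩
    rw [← A1] at hy
    obtain ⟨x, hx, rfl⟩ := hy
    rw [hgen, C.refl₂_φ (hΔ₁' hx).1]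
    exact ⟨x, hx, rfl⟩
  · exact fun y hy => hy.1.1
  · rintro y ⟨-, hy⟩
    rw [hgen] at hy
    obtain ⟨x, hx, hxy⟩ := hy
    exact ⟨C.φ x, A1 ▸ ⟨x, hx, rfl⟩, by rw [C.refl₂_φ (hΔ₁' hx).1, hxy]⟩
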